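/- Theorem 2. Let $0\le\theta<1$ and consider the following discrete-time single-server FIFO queue with an infinite buffer. At time $0$ there are $q_0\ge 0$ packets in the buffer (numbered $1,\dots,q_0$; $q_0$ may be random), and packet $q_0+m$ arrives just before epoch $m$ (at $m^-$), $m=1,2,\dots$, so that exactly one packet arrives in each block. The service times $T_1,T_2,\dots$ of the packets are i.i.d. Poisson random variables with mean $\theta$, independent of $q_0$; write $p_k=e^{-\theta}\theta^k/k!$. Let $a_n=\max(n-q_0,0)$ be the arrival epoch of packet $n$. Packet $n$ departs just after epoch $\tau_n$ (at $\tau_n^+$), where $\tau_0=0$ and $\tau_{n+1}=\max(\tau_n,a_{n+1})+T_{n+1}$. Let $L_n^+$ be the number of packets left in the buffer by packet $n$ at its departure, that is, the number of packets $k>n$ with $a_k\le\tau_n$, and let $Q_m^+$ be the number of packets in the queue at the block epoch $m^+$, that is, the number of packets $k\ge 1$ with $a_k\le m<\tau_k$. Then the limits $\pi_j=\lim_{n\to\infty}\Pr\{L_n^+=j\}$ and $v_j=\lim_{m\to\infty}\Pr\{Q_m^+=j\}$ exist for all $j\ge 0$; $\pi=(\pi_j)_{j\ge0}$ is the unique probability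 vector with $\pi\mathbf P=\pi$, where $\mathbf P$ is the transition matrix of $(L_n^+)$, given by $\mathbf P_{0j}=p_j$, and for $i\ge1$ by $\mathbf P_{ij}=p_{j-i+1}$ if $j\ge i-1$ and $\mathbf P_{ij}=0$ otherwise; and the stationary queue-length distributions at arbitrary block epochs and at departure epochs are the same: $v_j=\pi_j$ for all $j\ge 0$. Equivalently, the generating functions $V(z)=\sum_j v_jz^j$ and $L^+(z)=\sum_j\pi_jz^j$ converge and $V(z)=L^+(z)$ for all complex $|z|\le1$. -/

import Mathlib

open MeasureTheory ProbabilityTheory Filter Topology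
open scoped NNReal

/-! A discrete-time single-server FIFO queue with one arrival per block and an infinite buffer.
Packets are numbered `1, 2, 3, …`; at the start `q` packets (numbers `1, …, q`) are in the buffer,
and `t n` is the service time, in blocks, of packet `n + 1`.  At every epoch `m ≥ 1` one packet
arrives, just before the epoch (at `m⁻`); packets depart just after epochs (at `m⁺`). -/

/-- The epoch at which packet `n` arrives: packet `q + m` arrives at `m⁻`, and the truncated
subtraction assigns epoch `0` to the `q` packets that are initially present. -/
def arrivalEpoch (q n : ℕ) : ℕ := n - q

/-- The epoch at which packet `n` departs (`0` for the fictitious packet `0`).  The service of a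
packet starts at the epoch of its arrival or of the departure of its predecessor, whichever is
later; a packet with service time `0` departs at the epoch at which its service starts. -/
def departureEpoch (q : ℕ) (t : ℕ → ℕ) : ℕ → ℕ
  | 0 => 0
  | n + 1 => max (departureEpoch q t n) (arrivalEpoch q (n + 1)) + t n

/-- The number of packets left behind by packet `n` at its departure: the packets behind it in
the FIFO order that have arrived by its departure epoch. -/
noncomputable def queueAtDeparture (q : ℕ) (t : ℕ → ℕ) (n : ℕ) : ℕ :=
  Set.ncard {k : ℕ | n < k ∧ arrivalEpoch q k ≤ departureEpoch q t n}

/-- The number of packets in the queue at `m⁺`, after all arrivals at `m⁻` and all departures at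
`m⁺`: the packets that have arrived by epoch `m` and depart after it. -/
noncomputable def queueAtEpoch (q : ℕ) (t : ℕ → ℕ) (m : ℕ) : ℕ :=
  Set.ncard {k : ℕ | 1 ≤ k ∧ arrivalEpoch q k ≤ m ∧ m < departureEpoch q t k}

/-- The probability that a service takes exactly `k` blocks. -/
noncomputable def serviceProb (θ : ℝ≥0) (k : ℕ) : ℝ :=
  Real.exp (-(θ : ℝ)) * (θ : ℝ) ^ k / (Nat.factorial k : ℝ)

/-- The transition matrix of the queue length at departures: from `0` to `j` with
probability `p_j`, and from `i ≥ 1` to `i - 1 + k` with probability `p_k`. -/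
noncomputable def departureTransition (θ : ℝ≥0) : ℕ → ℕ → ℝ
  | 0, j => serviceProb θ j
  | i + 1, j => if i ≤ j then serviceProb θ (j - i) else 0

/-- `π` is a probability vector with `π P = π`. -/
structure IsStationaryDistribution (P : ℕ → ℕ → ℝ) (π : ℕ → ℝ) : Prop where
  nonneg : ∀ j, 0 ≤ π j
  sum_eq_one : HasSum π 1
  invariant : ∀ j, HasSum (fun i => π i * P i j) (π j)

/-- The probability generating function of `a` converges at `z` and has the value `w` there. -/
def HasPGFAt (a : ℕ → ℝ) (z w : ℂ) : Prop :=
  HasSum (fun j => (a j : ℂ) * z ^ j) w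

/-! Both queue lengths are read off one reflected walk W, with W_{n+1} = (W_n - 1)⁺ + T_{n+1} and
W_0 = q₀. The queue left by packet n is W_n. By FIFO the packets present at m⁺ are the last ones to
have arrived, so at most j are present iff packet q₀ + m - j has left by epoch m, that is, iff
W_{q₀+m-j} ≤ j (`queueAtEpoch_le_iff`). Given q₀ the index is deterministic and tends to infinity,
so both epochs inherit the limit law of W.

That law exists because θ < 1. By the strong law the walk has negative drift, hence it meets the
walk started at 0 and its start is forgotten. For start 0, reversing the order of the i.i.d.
services preserves the law at each fixed time and makes the walk monotone and bounded in n (Loynes),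
so it converges almost surely to a finite Z. The law of Z is invariant by passing to the limit in
the one-step equation. It is the only such law because column j of P expresses x_{j+1} through x_0,
…, x_j. -/

/-! ### The queue length at departures as a reflected walk -/

/-- The walk `x ↦ (x - 1)⁺ + t n` started at `q`. -/
def queueWalk (q : ℕ) (t : ℕ → ℕ) : ℕ → ℕ
  | 0 => q
  | n + 1 => queueWalk q t n - 1 + t n

/-- The walk started at `0` and driven by `t (n - 1), …, t 0`, in this order. -/
def reversedWalk : (ℕ → ℕ) → ℕ → ℕ
  | _, 0 => 0
  | t, n + 1 => reversedWalk (fun k => t (k + 1)) n - 1 + t 0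

/-- Since departure epochs are nonnegative, adding q undoes the truncation in the arrival epoch: the
maximum becomes max (W_n + n) (n + 1) = (W_n - 1)⁺ + n + 1. -/
lemma departureEpoch_add (q : ℕ) (t : ℕ → ℕ) (n : ℕ) :
    departureEpoch q t n + q = queueWalk q t n + n := by
  induction n with
  | zero => simp [departureEpoch, queueWalk]
  | succ n ih =>
    simp only [departureEpoch, queueWalk, arrivalEpoch]
    omega

lemma departureEpoch_mono (q : ℕ) (t : ℕ → ℕ) : Monotone (departureEpoch q t) :=
  monotone_nat_of_le_succ fun n => by
    simp only [departureEpoch]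
    omega

lemma queueAtDeparture_eq (q : ℕ) (t : ℕ → ℕ) (n : ℕ) :
    queueAtDeparture q t n = queueWalk q t n := by
  have h := departureEpoch_add q t n
  have hs : {k : ℕ | n < k ∧ arrivalEpoch q k ≤ departureEpoch q t n} =
      (Finset.Ioc n (n + queueWalk q t n) : Finset ℕ) := by
    ext k
    simp only [arrivalEpoch, Set.mem_ofPred_eq, Finset.coe_Ioc, Set.mem_Ioc]
    omega
  rw [queueAtDeparture, hs, Set.ncard_coe_finset, Nat.card_Ioc]
  omega

/-- Departure epochs are monotone, so the packets present form a final segment of 1, …, q + m.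
Everything hinges on whether packet q + m - j has departed by m, and `departureEpoch_add` turns this
into a bound on the walk. -/
lemma queueAtEpoch_le_iff (q : ℕ) (t : ℕ → ℕ) {m j : ℕ} (hj : j ≤ m) :
    queueAtEpoch q t m ≤ j ↔ queueWalk q t (q + m - j) ≤ j := by
  have h := departureEpoch_add q t (q + m - j)
  constructor
  · intro hQ
    by_contra! hlt
    have hsub : ((Finset.Icc (q + m - j) (q + m) : Finset ℕ) : Set ℕ) ⊆
        {k : ℕ | 1 ≤ k ∧ arrivalEpoch q k ≤ m ∧ m < departureEpoch q t k} := by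
      intro k hk
      simp only [Finset.coe_Icc, Set.mem_Icc] at hk
      have hmono := departureEpoch_mono q t hk.1
      have hpos : k ≠ 0 := by
        rintro rfl
        simp only [departureEpoch] at hmono
        omega
      simp only [arrivalEpoch, Set.mem_ofPred_eq]
      omega
    -- `ncard` is 0 on infinite sets, so finiteness is needed to compare cardinalities.
    have hfin : {k : ℕ | 1 ≤ k ∧ arrivalEpoch q k ≤ m ∧ m < departureEpoch q t k}.Finite :=
      (Set.finite_Iic (q + m)).subset fun k hk => by
        simp only [arrivalEpoch, Set.mem_ofPred_eq] at hk
        simp only [Set.mem_Iic]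
        omega
    have hcard := Set.ncard_le_ncard hsub hfin
    rw [Set.ncard_coe_finset, Nat.card_Icc] at hcard
    rw [queueAtEpoch] at hQ
    omega
  · intro hW
    have hsub : {k : ℕ | 1 ≤ k ∧ arrivalEpoch q k ≤ m ∧ m < departureEpoch q t k} ⊆
        ((Finset.Ioc (q + m - j) (q + m) : Finset ℕ) : Set ℕ) := by
      intro k hk
      simp only [arrivalEpoch, Set.mem_ofPred_eq] at hk
      simp only [Finset.coe_Ioc, Set.mem_Ioc]
      refine ⟨?_, by omega⟩
      by_contra! hle
      have hmono := departureEpoch_mono q t hle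
      omega
    have hcard := Set.ncard_le_ncard hsub (Finset.finite_toSet _)
    rw [Set.ncard_coe_finset, Nat.card_Ioc] at hcard
    rw [queueAtEpoch]
    omega

lemma queueWalk_congr {q : ℕ} {t t' : ℕ → ℕ} {n : ℕ} (h : ∀ k < n, t k = t' k) :
    queueWalk q t n = queueWalk q t' n := by
  induction n with
  | zero => rfl
  | succ n ih =>
    simp only [queueWalk]
    rw [ih fun k hk => h k (by omega), h n (by omega)]

/-! ### Coupling of initial values and time reversal -/

lemma queueWalk_mono_start {q q' : ℕ} (hq : q ≤ q') (t : ℕ → ℕ) (n : ℕ) :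
    queueWalk q t n ≤ queueWalk q' t n := by
  induction n with
  | zero => exact hq
  | succ n ih =>
    simp only [queueWalk]
    omega

/-- A service sequence with negative drift: the partial sums fall behind the number of services
by arbitrarily much. -/
def HasNegativeDrift (t : ℕ → ℕ) : Prop :=
  ∀ C : ℕ, ∀ᶠ n in atTop, ∑ k ∈ Finset.range n, t k + C < n

/-- Under negative drift the influence of the initial queue length vanishes. -/
lemma HasNegativeDrift.eventually_queueWalk_eq {t : ℕ → ℕ} (ht : HasNegativeDrift t) (q : ℕ) :
    ∀ᶠ n in atTop, queueWalk q t n = queueWalk 0 t n := by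
  have hhit : ∃ N, queueWalk q t N = 0 := by
    by_contra! hne
    -- As long as the walk avoids 0 no truncation occurs, so it is q plus the partial sum minus n;
    -- negative drift makes this impossible forever.
    have hsum : ∀ n, queueWalk q t n + n = ∑ k ∈ Finset.range n, t k + q := by
      intro n
      induction n with
      | zero => simp [queueWalk]
      | succ n ih =>
        have := hne n
        simp only [queueWalk, Finset.sum_range_succ]
        omega
    obtain ⟨n, hn⟩ := (ht q).exists
    have := hsum n
    omega
  obtain ⟨N, hN⟩ := hhit
  filter_upwards [eventually_ge_atTop N] with n hn
  induction n, hn using Nat.le_induction with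
  | base =>
    have := queueWalk_mono_start (Nat.zero_le q) t N
    omega
  | succ n _ ih => simp only [queueWalk, ih]

/-- Lengthening the reversed walk inserts an earlier step at the start, which replaces the initial 0
by something at least as large; each step map is monotone. -/
lemma reversedWalk_mono (t : ℕ → ℕ) : Monotone (reversedWalk t) := by
  refine monotone_nat_of_le_succ fun n => ?_
  induction n generalizing t with
  | zero => simp [reversedWalk]
  | succ n ih =>
    have := ih fun k => t (k + 1)
    rw [reversedWalk, reversedWalk]
    omega

lemma reversedWalk_le {t : ℕ → ℕ} {B : ℕ}
    (hB : ∀ n, ∑ k ∈ Finset.range (n + 1), t k ≤ n + B) (n : ℕ) : reversedWalk t n ≤ B := by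
  induction n generalizing t B with
  | zero => simp [reversedWalk]
  | succ n ih =>
    have h0 : t 0 ≤ B := by simpa using hB 0
    -- Removing the last step t 0 leaves the budget B + 1 - t 0, an exact subtraction because t 0 ≤
    -- B; the step x ↦ (x - 1)⁺ + t 0 brings it back to B.
    have := ih (t := fun k => t (k + 1)) (B := B + 1 - t 0) fun i => by
      have hi := hB (i + 1)
      rw [Finset.sum_range_succ'] at hi
      omega
    rw [reversedWalk]
    omega

lemma HasNegativeDrift.eventually_reversedWalk_eq {t : ℕ → ℕ} (ht : HasNegativeDrift t) :
    ∃ l, ∀ᶠ n in atTop, reversedWalk t n = l := by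
  obtain ⟨N, hN⟩ := eventually_atTop.1 (ht 0)
  have hB : ∀ n, reversedWalk t n ≤ ∑ k ∈ Finset.range N, t k :=
    reversedWalk_le fun n => by
      rcases le_total N (n + 1) with h | h
      · have := hN (n + 1) h
        omega
      · have := Finset.sum_le_sum_of_subset (f := t) (Finset.range_mono h)
        omega
  refine ⟨⨆ n, reversedWalk t n, tendsto_pure.1 ?_⟩
  rw [← nhds_discrete]
  exact tendsto_atTop_ciSup (reversedWalk_mono t) ⟨_, Set.forall_mem_range.2 hB⟩

/-- The permutation of `ℕ` that reverses the order of the first `n` numbers. -/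
def reverseBelow (n k : ℕ) : ℕ := if k < n then n - 1 - k else k

lemma reverseBelow_injective (n : ℕ) : Function.Injective (reverseBelow n) := by
  intro a b h
  simp only [reverseBelow] at h
  split_ifs at h <;> omega

lemma queueWalk_reverseBelow (t : ℕ → ℕ) (n : ℕ) :
    queueWalk 0 (fun k => t (reverseBelow n k)) n = reversedWalk t n := by
  induction n generalizing t with
  | zero => rfl
  | succ n ih =>
    rw [reversedWalk, queueWalk, ← ih]
    congr 2
    · refine queueWalk_congr fun k hk => ?_
      simp only [reverseBelow, hk, if_true, if_pos (Nat.lt_succ_of_lt hk)]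
      congr 1
      omega
    · simp [reverseBelow]

lemma measurable_queueWalk_comp {α : Type*} [MeasurableSpace α] {q : α → ℕ} (hq : Measurable q)
    {t : ℕ → α → ℕ} {n : ℕ} (ht : ∀ k < n, Measurable (t k)) :
    Measurable fun a => queueWalk (q a) (fun k => t k a) n := by
  induction n with
  | zero => exact hq
  | succ n ih =>
    have h1 := ih fun k hk => ht k (by omega)
    have h2 := ht n (by omega)
    exact (h1.sub_const 1).add h2

lemma measurable_queueWalk (q n : ℕ) : Measurable fun t : ℕ → ℕ => queueWalk q t n :=
  measurable_queueWalk_comp measurable_const fun k _ => measurable_pi_apply k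

lemma measurable_reversedWalk (n : ℕ) : Measurable fun t : ℕ → ℕ => reversedWalk t n := by
  simp only [← queueWalk_reverseBelow]
  exact (measurable_queueWalk 0 n).comp (measurable_pi_lambda _ fun k => measurable_pi_apply _)

/-! ### Uniqueness of the stationary distribution -/

lemma departureTransition_eq_zero (θ : ℝ≥0) {i j : ℕ} (h : j + 1 < i) :
    departureTransition θ i j = 0 := by
  obtain ⟨i, rfl⟩ : ∃ k, i = k + 1 := ⟨i - 1, by omega⟩
  simp only [departureTransition]
  exact if_neg (by omega)

lemma departureTransition_of_lt (θ : ℝ≥0) {i j : ℕ} (h : i < j + 2) :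
    departureTransition θ i j = serviceProb θ (j - (i - 1)) := by
  cases i with
  | zero => rfl
  | succ i =>
    simp only [departureTransition]
    rw [if_pos (by omega), Nat.add_sub_cancel]

lemma departureTransition_succ_self (θ : ℝ≥0) (j : ℕ) :
    departureTransition θ (j + 1) j = Real.exp (-(θ : ℝ)) := by
  simp [departureTransition, serviceProb]

lemma hasSum_mul_departureTransition (θ : ℝ≥0) (x : ℕ → ℝ) (j : ℕ) :
    HasSum (fun i => x i * departureTransition θ i j)
      (∑ i ∈ Finset.range (j + 2), x i * departureTransition θ i j) :=
  hasSum_sum_of_ne_finset_zero fun i hi => by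
    rw [Finset.mem_range] at hi
    rw [departureTransition_eq_zero θ (by omega), mul_zero]

lemma IsStationaryDistribution.sum_eq {θ : ℝ≥0} {x : ℕ → ℝ}
    (hx : IsStationaryDistribution (departureTransition θ) x) (j : ℕ) :
    ∑ i ∈ Finset.range (j + 2), x i * departureTransition θ i j = x j :=
  (hasSum_mul_departureTransition θ x j).unique (hx.invariant j)

/-- An invariant vector is determined by its value at `0`. -/
lemma eq_of_invariant_of_zero {θ : ℝ≥0} {x y : ℕ → ℝ}
    (hx : ∀ j, ∑ i ∈ Finset.range (j + 2), x i * departureTransition θ i j = x j)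
    (hy : ∀ j, ∑ i ∈ Finset.range (j + 2), y i * departureTransition θ i j = y j)
    (h0 : x 0 = y 0) : x = y := by
  funext j
  induction j using Nat.strong_induction_on with
  | _ j ih =>
    cases j with
    | zero => exact h0
    | succ j =>
      have h1 := hx j
      have h2 := hy j
      -- The last term of column j is x_{j+1} e^{-θ}, and e^{-θ} ≠ 0.
      rw [Finset.sum_range_succ, departureTransition_succ_self] at h1 h2
      have h3 : ∑ i ∈ Finset.range (j + 1), x i * departureTransition θ i j =
          ∑ i ∈ Finset.range (j + 1), y i * departureTransition θ i j :=
        Finset.sum_congr rfl fun i hi => by rw [ih i (Finset.mem_range.1 hi)]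
      have h4 := ih j (Nat.lt_succ_self j)
      exact mul_right_cancel₀ (Real.exp_pos (-(θ : ℝ))).ne' (by linarith)

lemma IsStationaryDistribution.unique {θ : ℝ≥0} {x y : ℕ → ℝ}
    (hx : IsStationaryDistribution (departureTransition θ) x)
    (hy : IsStationaryDistribution (departureTransition θ) y) : x = y := by
  -- Cross-scaling makes the values at 0 agree without dividing by them; comparing total masses then
  -- gives x 0 = y 0.
  have h : (fun j => y 0 * x j) = fun j => x 0 * y j :=
    eq_of_invariant_of_zero (θ := θ)
      (fun j => by simp only [mul_assoc, ← Finset.mul_sum, hx.sum_eq])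
      (fun j => by simp only [mul_assoc, ← Finset.mul_sum, hy.sum_eq]) (mul_comm _ _)
  have h1 := hx.sum_eq_one.mul_left (y 0)
  rw [h] at h1
  have h2 := h1.unique (hy.sum_eq_one.mul_left (x 0))
  exact eq_of_invariant_of_zero hx.sum_eq hy.sum_eq (by linarith)

/-! ### The Poisson service times -/

lemma hasSum_mean_poisson (θ : ℝ≥0) :
    HasSum (fun n : ℕ => Real.exp (-(θ : ℝ)) * (θ : ℝ) ^ n / (n.factorial : ℝ) * (n : ℝ)) θ := by
  -- The term n = 0 vanishes, and (n + 1) p_{n+1} = θ p_n.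
  rw [← hasSum_nat_add_iff' 1]
  simp only [Finset.range_one, Finset.sum_singleton, Nat.cast_zero, mul_zero, sub_zero]
  have h := (hasSum_one_poissonMeasure θ).mul_left (θ : ℝ)
  rw [mul_one] at h
  refine h.congr_fun fun n => ?_
  rw [Nat.factorial_succ]
  push_cast
  have : (n.factorial : ℝ) ≠ 0 := by positivity
  field_simp
  ring

lemma integrable_cast_poissonMeasure (θ : ℝ≥0) :
    Integrable (fun n : ℕ => (n : ℝ)) (poissonMeasure θ) := by
  rw [integrable_poissonMeasure_iff]
  simpa using (hasSum_mean_poisson θ).summable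

lemma integral_cast_poissonMeasure (θ : ℝ≥0) : ∫ n : ℕ, (n : ℝ) ∂poissonMeasure θ = θ := by
  rw [integral_poissonMeasure]
  simpa using (hasSum_mean_poisson θ).tsum_eq

lemma hasNegativeDrift_of_tendsto {t : ℕ → ℕ} {a : ℝ} (ha : a < 1)
    (h : Tendsto (fun n : ℕ => (∑ k ∈ Finset.range n, (t k : ℝ)) / n) atTop (𝓝 a)) :
    HasNegativeDrift t := by
  intro C
  obtain ⟨r, har, hr⟩ := exists_between ha
  have hC : ∀ᶠ n : ℕ in atTop, (C : ℝ) / (1 - r) < n :=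
    tendsto_natCast_atTop_atTop.eventually_gt_atTop _
  filter_upwards [h.eventually_lt_const har, hC, eventually_gt_atTop 0] with n h1 h2 h3
  have hn : (0 : ℝ) < n := by exact_mod_cast h3
  rw [div_lt_iff₀ hn] at h1
  rw [div_lt_iff₀ (by linarith)] at h2
  have : (∑ k ∈ Finset.range n, (t k : ℝ)) + C < n := by linarith
  exact_mod_cast this

/-! ### Limit law of the walk -/

section Probability

variable {Ω : Type*} [MeasurableSpace Ω] {μ : Measure Ω} {θ : ℝ≥0}
  {T : ℕ → Ω → ℕ}

lemma ae_hasNegativeDrift (hθ : θ < 1) (hT : ∀ n, Measurable (T n)) (hTindep : iIndepFun T μ)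
    (hTlaw : ∀ n, μ.map (T n) = poissonMeasure θ) :
    ∀ᵐ ω ∂μ, HasNegativeDrift fun k => T k ω := by
  have hc : Measurable fun n : ℕ => (n : ℝ) := measurable_of_countable _
  have hint : Integrable (fun ω => (T 0 ω : ℝ)) μ := by
    have := integrable_cast_poissonMeasure θ
    rw [← hTlaw 0] at this
    exact this.comp_measurable (hT 0)
  have hmean : ∫ ω, (T 0 ω : ℝ) ∂μ = θ := by
    rw [← integral_cast_poissonMeasure θ, ← hTlaw 0]
    exact (integral_map (hT 0).aemeasurable hc.aestronglyMeasurable).symm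
  have hlln := strong_law_ae_real (μ := μ) (fun n ω => (T n ω : ℝ)) hint
    (fun i j hij => (hTindep.indepFun hij).comp hc hc)
    (fun i => (IdentDistrib.mk (hT i).aemeasurable (hT 0).aemeasurable
      ((hTlaw i).trans (hTlaw 0).symm)).comp hc)
  filter_upwards [hlln] with ω hω
  rw [hmean] at hω
  exact hasNegativeDrift_of_tendsto (by exact_mod_cast hθ) hω

/-- The law of an i.i.d. sequence is invariant under injective reindexing. -/
lemma identDistrib_reindex (hT : ∀ n, Measurable (T n)) (hTindep : iIndepFun T μ)
    (hTlaw : ∀ n, μ.map (T n) = poissonMeasure θ) {g : ℕ → ℕ} (hg : Function.Injective g) :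
    IdentDistrib (fun ω k => T (g k) ω) (fun ω k => T k ω) μ μ where
  aemeasurable_fst := (measurable_pi_lambda _ fun k => hT (g k)).aemeasurable
  aemeasurable_snd := (measurable_pi_lambda _ hT).aemeasurable
  map_eq := by
    rw [(hTindep.precomp hg).map_fun_eq_infinitePi_map fun k => hT (g k),
      hTindep.map_fun_eq_infinitePi_map hT]
    simp only [hTlaw]

/-- Reversal preserves only the law at each fixed n, not the joint law over n; this suffices for the
limits of probabilities. -/
lemma measureReal_queueWalk_zero (hT : ∀ n, Measurable (T n)) (hTindep : iIndepFun T μ)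
    (hTlaw : ∀ n, μ.map (T n) = poissonMeasure θ) (n j : ℕ) :
    μ.real {ω | queueWalk 0 (fun k => T k ω) n = j} =
      μ.real {ω | reversedWalk (fun k => T k ω) n = j} := by
  have h := (identDistrib_reindex hT hTindep hTlaw (reverseBelow_injective n)).comp
    (measurable_queueWalk 0 n)
  have h1 := h.measure_mem_eq (measurableSet_singleton j)
  simp only [Function.comp_def, Set.preimage, Set.mem_singleton_iff] at h1
  have h2 : ∀ ω, queueWalk 0 (fun k => T (reverseBelow n k) ω) n =
      reversedWalk (fun k => T k ω) n := fun ω => queueWalk_reverseBelow (fun k => T k ω) n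
  simp only [h2] at h1
  rw [measureReal_def, measureReal_def, h1]

lemma indepFun_queueWalk (hT : ∀ n, Measurable (T n)) (hTindep : iIndepFun T μ) (n : ℕ) :
    IndepFun (fun ω => queueWalk 0 (fun k => T k ω) n) (T n) μ := by
  have h := hTindep.indepFun_finset (Finset.range n) {n} (by simp) hT
  -- The walk at time n reads only the first n services, so padding with 0 loses nothing.
  have hφ : Measurable fun x : Finset.range n → ℕ =>
      queueWalk 0 (fun k => if hk : k ∈ Finset.range n then x ⟨k, hk⟩ else 0) n := by
    refine measurable_queueWalk_comp (t := fun k (x : Finset.range n → ℕ) => if hk : k ∈ Finset.range n then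
      x ⟨k, hk⟩ else 0) measurable_const fun k hk => ?_
    simp only [Finset.mem_range.2 hk, dif_pos]
    exact measurable_pi_apply _
  have hψ : Measurable fun x : ({n} : Finset ℕ) → ℕ => x ⟨n, Finset.mem_singleton_self n⟩ :=
    measurable_pi_apply _
  have hcomp := h.comp hφ hψ
  refine hcomp.congr (Eventually.of_forall fun ω => ?_) (Eventually.of_forall fun ω => rfl)
  exact queueWalk_congr fun k hk => by simp [hk]

variable [IsProbabilityMeasure μ]

lemma hasSum_measureReal_inter_fiber {Z : Ω → ℕ} (hZ : Measurable Z) {A : Set Ω}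
    (hA : MeasurableSet A) : HasSum (fun c => μ.real (A ∩ {ω | Z ω = c})) (μ.real A) := by
  have hm : ∀ c, MeasurableSet (A ∩ {ω | Z ω = c}) := fun c =>
    hA.inter (hZ (measurableSet_singleton c))
  have hd : Pairwise (Function.onFun Disjoint fun c => A ∩ {ω | Z ω = c}) := fun a b hab =>
    Set.disjoint_left.2 fun ω ha hb => hab (ha.2.symm.trans hb.2)
  have hU : ⋃ c, A ∩ {ω | Z ω = c} = A := by
    ext ω
    simp
  have h := measure_iUnion (μ := μ) hd hm
  rw [hU] at h
  have h2 := ENNReal.hasSum_toReal (f := fun c => μ (A ∩ {ω | Z ω = c}))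
    (h ▸ measure_ne_top μ A)
  rwa [← ENNReal.tsum_toReal_eq fun c => measure_ne_top μ _, ← h] at h2

lemma hasSum_measureReal_fiber {Z : Ω → ℕ} (hZ : Measurable Z) :
    HasSum (fun c => μ.real {ω | Z ω = c}) 1 := by
  simpa using hasSum_measureReal_inter_fiber (μ := μ) hZ MeasurableSet.univ

lemma measureReal_le_eq_sum {Z : Ω → ℕ} (hZ : Measurable Z) (j : ℕ) :
    μ.real {ω | Z ω ≤ j} = ∑ i ∈ Finset.range (j + 1), μ.real {ω | Z ω = i} := by
  have h := sum_measureReal_preimage_singleton (μ := μ) (Finset.range (j + 1)) (f := Z)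
    fun y _ => hZ (measurableSet_singleton y)
  refine Eq.trans ?_ h.symm
  congr 1
  ext ω
  simp

lemma measureReal_queueWalk_succ (hT : ∀ n, Measurable (T n)) (hTindep : iIndepFun T μ)
    (hTlaw : ∀ n, μ.map (T n) = poissonMeasure θ) (n j : ℕ) :
    μ.real {ω | queueWalk 0 (fun k => T k ω) (n + 1) = j} =
      ∑ i ∈ Finset.range (j + 2),
        μ.real {ω | queueWalk 0 (fun k => T k ω) n = i} * departureTransition θ i j := by
  have hX : Measurable fun ω => queueWalk 0 (fun k => T k ω) n :=
    measurable_queueWalk_comp measurable_const fun k _ => hT k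
  -- Truncation in i - 1 treats i = 0 and i = 1 alike, as rows 0 and 1 of P coincide.
  have hset : {ω | queueWalk 0 (fun k => T k ω) (n + 1) = j} =
      ⋃ i ∈ Finset.range (j + 2), (fun ω => queueWalk 0 (fun k => T k ω) n) ⁻¹' {i} ∩
        T n ⁻¹' {j - (i - 1)} := by
    ext ω
    simp only [queueWalk, Set.mem_ofPred_eq, Set.mem_iUnion, Finset.mem_range, Set.mem_inter_iff,
      Set.mem_preimage, Set.mem_singleton_iff, exists_prop, existsAndEq, true_and]
    omega
  rw [hset, measureReal_biUnion_finset]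
  · refine Finset.sum_congr rfl fun i hi => ?_
    rw [measureReal_def, (indepFun_queueWalk hT hTindep n).measure_inter_preimage_eq_mul _ _
      (measurableSet_singleton i) (measurableSet_singleton _), ENNReal.toReal_mul,
      departureTransition_of_lt θ (Finset.mem_range.1 hi),
      ← Measure.map_apply (hT n) (measurableSet_singleton _), hTlaw n, ← measureReal_def,
      ← measureReal_def, poissonMeasure_real_singleton]
    rfl
  · exact fun a _ b _ hab => Set.disjoint_left.2 fun ω ha hb => hab (ha.1.symm.trans hb.1)
  · exact fun i _ => (hX (measurableSet_singleton i)).inter (hT n (measurableSet_singleton _))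

lemma tendsto_measureReal_of_ae_eventually {X : ℕ → Ω → ℕ} {Z : Ω → ℕ}
    (hX : ∀ n, Measurable (X n)) (hZ : Measurable Z)
    (h : ∀ᵐ ω ∂μ, ∀ᶠ n in atTop, X n ω = Z ω) (j : ℕ) :
    Tendsto (fun n => μ.real {ω | X n ω = j}) atTop (𝓝 (μ.real {ω | Z ω = j})) := by
  refine (ENNReal.tendsto_toReal (measure_ne_top μ _)).comp
    (tendsto_measure_of_ae_tendsto_indicator_of_isFiniteMeasure atTop
      (hZ (measurableSet_singleton j)) (fun n => hX n (measurableSet_singleton j)) ?_)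
  filter_upwards [h] with ω hω
  filter_upwards [hω] with n hn
  simp [hn]

/-- The limit of the reversed walk is almost surely finite, and its law is the limit law of the
walk started at `0`. -/
lemma exists_limit_queueWalk_zero (hθ : θ < 1) (hT : ∀ n, Measurable (T n))
    (hTindep : iIndepFun T μ) (hTlaw : ∀ n, μ.map (T n) = poissonMeasure θ) :
    ∃ Z : Ω → ℕ, Measurable Z ∧ ∀ j, Tendsto
      (fun n => μ.real {ω | queueWalk 0 (fun k => T k ω) n = j}) atTop
      (𝓝 (μ.real {ω | Z ω = j})) := by
  have hX : ∀ n, Measurable fun ω => reversedWalk (fun k => T k ω) n := fun n =>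
    (measurable_reversedWalk n).comp (measurable_pi_lambda _ hT)
  obtain ⟨Z, hZ, hlim⟩ := measurable_limit_of_tendsto_metrizable_ae (μ := μ) (L := atTop)
    (fun n => (hX n).aemeasurable) (by
      filter_upwards [ae_hasNegativeDrift hθ hT hTindep hTlaw] with ω hω
      obtain ⟨l, hl⟩ := hω.eventually_reversedWalk_eq
      exact ⟨l, tendsto_const_nhds.congr' (hl.mono fun n hn => hn.symm)⟩)
  refine ⟨Z, hZ, fun j => ?_⟩
  simp only [measureReal_queueWalk_zero hT hTindep hTlaw]
  refine tendsto_measureReal_of_ae_eventually hX hZ ?_ j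
  filter_upwards [hlim] with ω hω
  rwa [nhds_discrete, tendsto_pure] at hω

/-- No mass escapes because Z takes values in ℕ. Each column of P has finite support, so the
one-step equation passes to the limit termwise. -/
lemma isStationaryDistribution_limit {Z : Ω → ℕ} (hZ : Measurable Z) (hT : ∀ n, Measurable (T n))
    (hTindep : iIndepFun T μ) (hTlaw : ∀ n, μ.map (T n) = poissonMeasure θ)
    (hlim : ∀ j, Tendsto (fun n => μ.real {ω | queueWalk 0 (fun k => T k ω) n = j}) atTop
      (𝓝 (μ.real {ω | Z ω = j}))) :
    IsStationaryDistribution (departureTransition θ) fun j => μ.real {ω | Z ω = j} where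
  nonneg _ := measureReal_nonneg
  sum_eq_one := hasSum_measureReal_fiber hZ
  invariant j := by
    have h1 := (hlim j).comp (tendsto_add_atTop_nat 1)
    simp only [Function.comp_def, measureReal_queueWalk_succ hT hTindep hTlaw] at h1
    rw [tendsto_nhds_unique h1
      (tendsto_finsetSum _ fun i _ => (hlim i).mul_const (departureTransition θ i j))]
    exact hasSum_mul_departureTransition θ _ j

/-- The limit law of the walk does not depend on the initial value. -/
lemma tendsto_measureReal_queueWalk (hθ : θ < 1) (hT : ∀ n, Measurable (T n))
    (hTindep : iIndepFun T μ) (hTlaw : ∀ n, μ.map (T n) = poissonMeasure θ)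
    {q : Ω → ℕ} (hq : Measurable q) {j : ℕ} {a : ℝ}
    (hlim : Tendsto (fun n => μ.real {ω | queueWalk 0 (fun k => T k ω) n = j}) atTop (𝓝 a)) :
    Tendsto (fun n => μ.real {ω | queueWalk (q ω) (fun k => T k ω) n = j}) atTop (𝓝 a) := by
  have hX : ∀ n, Measurable fun ω => queueWalk (q ω) (fun k => T k ω) n := fun n =>
    measurable_queueWalk_comp hq fun k _ => hT k
  have hX0 : ∀ n, Measurable fun ω => queueWalk 0 (fun k => T k ω) n := fun n =>
    measurable_queueWalk_comp measurable_const fun k _ => hT k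
  -- The walk from q dominates the walk from 0, so a zero truncated difference means equality.
  have hdiff : Tendsto (fun n => μ.real
      {ω | queueWalk (q ω) (fun k => T k ω) n - queueWalk 0 (fun k => T k ω) n = 0}) atTop
      (𝓝 (μ.real {ω : Ω | (fun _ => 0 : Ω → ℕ) ω = 0})) := by
    refine tendsto_measureReal_of_ae_eventually (fun n => (hX n).sub (hX0 n)) measurable_const ?_ 0
    filter_upwards [ae_hasNegativeDrift hθ hT hTindep hTlaw] with ω hω
    filter_upwards [hω.eventually_queueWalk_eq (q ω)] with n hn
    simp [hn]
  have hdiff' : Tendsto (fun n => 1 - μ.real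
      {ω | queueWalk (q ω) (fun k => T k ω) n - queueWalk 0 (fun k => T k ω) n = 0}) atTop
      (𝓝 0) := by
    simpa using hdiff.const_sub 1
  refine tendsto_of_tendsto_of_dist hlim
    (squeeze_zero (fun n => dist_nonneg) (fun n => ?_) hdiff')
  have hE : MeasurableSet
      {ω | queueWalk (q ω) (fun k => T k ω) n - queueWalk 0 (fun k => T k ω) n = 0} :=
    ((hX n).sub (hX0 n)) (measurableSet_singleton 0)
  rw [Real.dist_eq, ← probReal_compl_eq_one_sub hE]
  refine (abs_measureReal_sub_le_measureReal_symmDiff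
    (hX0 n (measurableSet_singleton j)).nullMeasurableSet
    (hX n (measurableSet_singleton j)).nullMeasurableSet).trans
    (measureReal_mono ?_)
  intro ω hω hω'
  have hle := queueWalk_mono_start (Nat.zero_le (q ω)) (fun k => T k ω) n
  have heq : queueWalk (q ω) (fun k => T k ω) n = queueWalk 0 (fun k => T k ω) n := by
    simp only [Set.mem_ofPred_eq] at hω'
    omega
  simp [Set.mem_symmDiff, heq] at hω

lemma tendsto_measureReal_queueWalk_le (hθ : θ < 1) (hT : ∀ n, Measurable (T n))
    (hTindep : iIndepFun T μ) (hTlaw : ∀ n, μ.map (T n) = poissonMeasure θ) {a : ℕ → ℝ}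
    (hlim : ∀ j, Tendsto (fun n => μ.real {ω | queueWalk 0 (fun k => T k ω) n = j}) atTop
      (𝓝 (a j))) (c j : ℕ) :
    Tendsto (fun n => μ.real {ω | queueWalk c (fun k => T k ω) n ≤ j}) atTop
      (𝓝 (∑ i ∈ Finset.range (j + 1), a i)) := by
  have hX : ∀ n, Measurable fun ω => queueWalk c (fun k => T k ω) n := fun n =>
    measurable_queueWalk_comp measurable_const fun k _ => hT k
  simp only [measureReal_le_eq_sum (hX _)]
  exact tendsto_finsetSum _ fun i _ =>
    tendsto_measureReal_queueWalk hθ hT hTindep hTlaw measurable_const (hlim i)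

/-! ### Queue length at block epochs -/

lemma measurableSet_queueAtEpoch_le (hT : ∀ n, Measurable (T n)) {q : Ω → ℕ} (hq : Measurable q)
    {m j : ℕ} (hj : j ≤ m) : MeasurableSet {ω | queueAtEpoch (q ω) (fun k => T k ω) m ≤ j} := by
  have hset : {ω | queueAtEpoch (q ω) (fun k => T k ω) m ≤ j} =
      ⋃ c, {ω | queueWalk c (fun k => T k ω) (c + m - j) ≤ j} ∩ {ω | q ω = c} := by
    ext ω
    simp [queueAtEpoch_le_iff _ _ hj]
  rw [hset]
  refine MeasurableSet.iUnion fun c => MeasurableSet.inter ?_ (hq (measurableSet_singleton c))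
  exact measurableSet_le (measurable_queueWalk_comp measurable_const fun k _ => hT k)
    measurable_const

/-- Conditioning on the initial queue length. -/
lemma measureReal_queueAtEpoch_le (hT : ∀ n, Measurable (T n)) {q : Ω → ℕ} (hq : Measurable q)
    (hqT : IndepFun q (fun ω n => T n ω) μ) {m j : ℕ} (hj : j ≤ m) :
    μ.real {ω | queueAtEpoch (q ω) (fun k => T k ω) m ≤ j} =
      ∑' c, μ.real {ω | q ω = c} *
        μ.real {ω | queueWalk c (fun k => T k ω) (c + m - j) ≤ j} := by
  rw [← (hasSum_measureReal_inter_fiber hq (measurableSet_queueAtEpoch_le hT hq hj)).tsum_eq]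
  refine tsum_congr fun c => ?_
  have hset : {ω | queueAtEpoch (q ω) (fun k => T k ω) m ≤ j} ∩ {ω | q ω = c} =
      q ⁻¹' {c} ∩ (fun ω n => T n ω) ⁻¹' {t | queueWalk c t (c + m - j) ≤ j} := by
    ext ω
    simp only [queueAtEpoch_le_iff _ _ hj, Set.mem_inter_iff, Set.mem_ofPred_eq, Set.mem_preimage,
      Set.mem_singleton_iff]
    constructor
    · rintro ⟨h, rfl⟩
      exact ⟨rfl, h⟩
    · rintro ⟨rfl, h⟩
      exact ⟨h, rfl⟩
  rw [hset, measureReal_def, hqT.measure_inter_preimage_eq_mul _ _ (measurableSet_singleton c)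
    (measurableSet_le (measurable_queueWalk c _) measurable_const), ENNReal.toReal_mul]
  rfl

lemma tendsto_measureReal_queueAtEpoch_le (hθ : θ < 1) (hT : ∀ n, Measurable (T n))
    (hTindep : iIndepFun T μ) (hTlaw : ∀ n, μ.map (T n) = poissonMeasure θ) {a : ℕ → ℝ}
    (hlim : ∀ j, Tendsto (fun n => μ.real {ω | queueWalk 0 (fun k => T k ω) n = j}) atTop
      (𝓝 (a j))) {q : Ω → ℕ} (hq : Measurable q) (hqT : IndepFun q (fun ω n => T n ω) μ) (j : ℕ) :
    Tendsto (fun m => μ.real {ω | queueAtEpoch (q ω) (fun k => T k ω) m ≤ j}) atTop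
      (𝓝 (∑ i ∈ Finset.range (j + 1), a i)) := by
  have hq1 := hasSum_measureReal_fiber (μ := μ) hq
  -- The law of q₀ is the summable bound that lets the limit pass through the sum over initial
  -- lengths.
  have h := tendsto_tsum_of_dominated_convergence (𝓕 := atTop)
    (f := fun m c => μ.real {ω | q ω = c} *
      μ.real {ω | queueWalk c (fun k => T k ω) (c + m - j) ≤ j})
    (g := fun c => μ.real {ω | q ω = c} * ∑ i ∈ Finset.range (j + 1), a i) hq1.summable
    (fun c => ((tendsto_measureReal_queueWalk_le hθ hT hTindep hTlaw hlim c j).comp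
      ((tendsto_sub_atTop_nat j).comp (tendsto_atTop_mono (fun m => Nat.le_add_left m c)
        tendsto_id))).const_mul _)
    (Eventually.of_forall fun m c => by
      rw [Real.norm_of_nonneg (by positivity)]
      exact mul_le_of_le_one_right measureReal_nonneg measureReal_le_one)
  rw [tsum_mul_right, hq1.tsum_eq, one_mul] at h
  refine h.congr' ?_
  filter_upwards [eventually_ge_atTop j] with m hm
  exact (measureReal_queueAtEpoch_le hT hq hqT hm).symm

lemma tendsto_measureReal_queueAtEpoch (hθ : θ < 1) (hT : ∀ n, Measurable (T n))
    (hTindep : iIndepFun T μ) (hTlaw : ∀ n, μ.map (T n) = poissonMeasure θ) {a : ℕ → ℝ}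
    (hlim : ∀ j, Tendsto (fun n => μ.real {ω | queueWalk 0 (fun k => T k ω) n = j}) atTop
      (𝓝 (a j))) {q : Ω → ℕ} (hq : Measurable q) (hqT : IndepFun q (fun ω n => T n ω) μ) (j : ℕ) :
    Tendsto (fun m => μ.real {ω | queueAtEpoch (q ω) (fun k => T k ω) m = j}) atTop
      (𝓝 (a j)) := by
  have hle := tendsto_measureReal_queueAtEpoch_le hθ hT hTindep hTlaw hlim hq hqT
  cases j with
  | zero => simpa using hle 0
  | succ j =>
    have h := (hle (j + 1)).sub (hle j)
    rw [Finset.sum_range_succ _ (j + 1), add_sub_cancel_left] at h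
    refine h.congr' ?_
    filter_upwards [eventually_ge_atTop j] with m hm
    have hsub : {ω | queueAtEpoch (q ω) (fun k => T k ω) m ≤ j} ⊆
        {ω | queueAtEpoch (q ω) (fun k => T k ω) m ≤ j + 1} := fun ω hω =>
      le_trans hω (Nat.le_succ j)
    rw [← measureReal_sdiff hsub (measurableSet_queueAtEpoch_le hT hq hm)]
    congr 1
    ext ω
    simp only [Set.mem_sdiff, Set.mem_ofPred_eq]
    omega

end Probability

lemma summable_mul_pow_of_norm_le_one {a : ℕ → ℝ} (ha : Summable a) (ha0 : ∀ j, 0 ≤ a j) {z : ℂ}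
    (hz : ‖z‖ ≤ 1) : Summable fun j => (a j : ℂ) * z ^ j :=
  ha.of_norm_bounded fun j => by
    rw [norm_mul, norm_pow, Complex.norm_real, Real.norm_of_nonneg (ha0 j)]
    exact mul_le_of_le_one_right (ha0 j) (pow_le_one₀ (norm_nonneg z) hz)

theorem theorem2 {Ω : Type*} [MeasurableSpace Ω] (μ : Measure Ω) [IsProbabilityMeasure μ]
    (θ : ℝ≥0) (hθ : θ < 1)
    (q₀ : Ω → ℕ) (hq₀ : Measurable q₀)
    (T : ℕ → Ω → ℕ) (hT : ∀ n, Measurable (T n))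
    (hTindep : iIndepFun T μ)
    (hTlaw : ∀ n, μ.map (T n) = poissonMeasure θ)
    (hq₀T : IndepFun q₀ (fun ω n => T n ω) μ) :
    ∃ π v : ℕ → ℝ,
      IsStationaryDistribution (departureTransition θ) π ∧
      (∀ π' : ℕ → ℝ, IsStationaryDistribution (departureTransition θ) π' → π' = π) ∧
      (∀ j, Tendsto
        (fun n => μ.real {ω | queueAtDeparture (q₀ ω) (fun k => T k ω) n = j}) atTop (𝓝 (π j))) ∧
      (∀ j, Tendsto
        (fun m => μ.real {ω | queueAtEpoch (q₀ ω) (fun k => T k ω) m = j}) atTop (𝓝 (v j))) ∧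
      v = π ∧
      ∀ z : ℂ, ‖z‖ ≤ 1 → ∃ w : ℂ, HasPGFAt v z w ∧ HasPGFAt π z w := by
  obtain ⟨Z, hZ, hlim⟩ := exists_limit_queueWalk_zero hθ hT hTindep hTlaw
  have hstat := isStationaryDistribution_limit hZ hT hTindep hTlaw hlim
  refine ⟨_, _, hstat, fun π' hπ' => hπ'.unique hstat, fun j => ?_,
    tendsto_measureReal_queueAtEpoch hθ hT hTindep hTlaw hlim hq₀ hq₀T, rfl, fun z hz => ?_⟩
  · simp only [queueAtDeparture_eq]
    exact tendsto_measureReal_queueWalk hθ hT hTindep hTlaw hq₀ (hlim j)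
  · have h := (summable_mul_pow_of_norm_le_one hstat.sum_eq_one.summable hstat.nonneg hz).hasSum
    exact ⟨_, h, h⟩
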